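/- Let $\mathbb V$ be a Euclidean space and let $\mathbb X,\mathbb Y$ be Euclidean Jordan algebras, i.e. finite-dimensional real inner product spaces with a bilinear commutative product $\circ$ that satisfies the Jordan identity $x\circ((x\circ x)\circ y)=(x\circ x)\circ(x\circ y)$, has a unit element ($e_{\mathbb X}$, resp. $e_{\mathbb Y}$), and satisfies $\langle x\circ y,z\rangle=\langle y,x\circ z\rangle$. Let $K_{\mathbb X}=\{z\circ z: z\in\mathbb X\}$ and $K_{\mathbb Y}=\{z\circ z: z\in\mathbb Y\}$ be their symmetric cones. Let $G:\mathbb X\to\mathbb V$ and $H:\mathbb Y\to\mathbb V$ be linear maps such that $P=G(K_{\mathbb X})$ and $Q=H(K_{\mathbb Y})$ are LISC cones: $P$ and $Q$ are closed convex cones with $P\cap(-P)=\{0\}=Q\cap(-Q)$, and $G(c)\neq 0$, $H(d)\neq0$ for all primitive idempotents $c\in\mathbb X$, $d\in\mathbb Y$ (a primitive idempotent is a nonzero $c$ with $c\circ c=c$ that is not the sum of two nonzero idempotents). Let $\Delta_{\mathbb X}=\{x\in K_{\mathbb X}:\langle e_{\mathbb X},x\rangle=1\}$ and $\Delta_{\mathbb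 Y}=\{y\in K_{\mathbb Y}:\langle e_{\mathbb Y},y\rangle=1\}$. Consider the fractional program $$\mathrm{FP}:\quad \min\ \Phi(x,y)=\frac{\langle Gx,Hy\rangle}{\|Gx\|\,\|Hy\|}\quad\text{s.t. } (x,y)\in\Delta_{\mathbb X}\times\Delta_{\mathbb Y},$$ and, for $\delta\in\mathbb R$, the biconvex parametric program $$\mathrm{BCP}_\delta:\quad \min\ f_\delta(x,y)=\langle Gx,Hy\rangle-\delta\,\|Gx\|\,\|Hy\|\quad\text{s.t. } (x,y)\in\Delta_{\mathbb X}\times\Delta_{\mathbb Y}.$$ A solution of either program is a global minimizer over $\Delta_{\mathbb X}\times\Delta_{\mathbb Y}$. A pair $(\bar x,\bar y)$ is a stationary point of the program with objective $\Psi\in\{\Phi,f_\delta\}$ if $\Psi$ is differentiable at $(\bar x,\bar y)$, $\langle e_{\mathbb X},\bar x\rangle=1$, $\langle e_{\mathbb Y},\bar y\rangle=1$, and there are $\gamma_1,\gamma_2\in\mathbb R$ with $$K_{\mathbb X}\ni\bar x\perp\nabla_x\Psi(\bar x,\bar y)+\gamma_1e_{\mathbb X}\in K_{\mathbb X}^*,\qquad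 K_{\mathbb Y}\ni\bar y\perp\nabla_y\Psi(\bar x,\bar y)+\gamma_2e_{\mathbb Y}\in K_{\mathbb Y}^*,$$ where $K^*=\{\zeta:\langle\zeta,u\rangle\ge0\ \forall u\in K\}$ is the dual cone. Let $(\bar x,\bar y)\in\mathbb X\times\mathbb Y$ and put $\delta=\dfrac{\langle G\bar x,H\bar y\rangle}{\|G\bar x\|\,\|H\bar y\|}$ (a quotient by zero is read as $0$; this does not occur on $\Delta_{\mathbb X}\times\Delta_{\mathbb Y}$). Then: 1. $(\bar x,\bar y)$ is a stationary point of $\mathrm{BCP}_\delta$ if and only if it is a stationary point of $\mathrm{FP}$; 2. $(\bar x,\bar y)$ is a solution of $\mathrm{BCP}_\delta$ if and only if it is a solution of $\mathrm{FP}$. -/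

import Mathlib

open scoped InnerProductSpace

/-- A Euclidean Jordan algebra structure on a finite-dimensional real inner product space `X`:
a bilinear commutative product satisfying the Jordan identity, with a unit element, for which the
inner product of `X` is associative (every multiplication operator is self-adjoint). -/
structure EuclideanJordanAlgebra (X : Type*) [NormedAddCommGroup X] [InnerProductSpace ℝ X]
    [FiniteDimensional ℝ X] where
  /-- the Jordan product `x ∘ y` -/
  mul : X →ₗ[ℝ] X →ₗ[ℝ] X
  /-- the unit element -/
  e : X
  mul_comm : ∀ x y, mul x y = mul y x
  jordan : ∀ x y, mul x (mul (mul x x) y) = mul (mul x x) (mul x y)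
  e_mul : ∀ x, mul e x = x
  inner_mul : ∀ x y z, ⟪mul x y, z⟫_ℝ = ⟪y, mul x z⟫_ℝ

namespace EuclideanJordanAlgebra

variable {X : Type*} [NormedAddCommGroup X] [InnerProductSpace ℝ X] [FiniteDimensional ℝ X]

/-- The symmetric cone of the algebra: the set of squares. -/
def symCone (J : EuclideanJordanAlgebra X) : Set X := {x | ∃ z, x = J.mul z z}

def IsIdempotent (J : EuclideanJordanAlgebra X) (c : X) : Prop := J.mul c c = c

/-- A primitive idempotent: a nonzero idempotent that is not a sum of two nonzero idempotents. -/
def IsPrimitive (J : EuclideanJordanAlgebra X) (c : X) : Prop :=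
  J.IsIdempotent c ∧ c ≠ 0 ∧
    ¬ ∃ a b, J.IsIdempotent a ∧ a ≠ 0 ∧ J.IsIdempotent b ∧ b ≠ 0 ∧ c = a + b

end EuclideanJordanAlgebra

/-- The closed convex cone `P` is a LISC cone (linear image of a symmetric cone), represented as
`P = G(K)` with `K` the symmetric cone of the Euclidean Jordan algebra `J`. (A `ProperCone` of
Mathlib is a nonempty closed convex cone; it need not have interior points nor be pointed in the
sense of `pointed` below.) -/
structure IsLISC {X V : Type*} [NormedAddCommGroup X] [InnerProductSpace ℝ X]
    [FiniteDimensional ℝ X] [NormedAddCommGroup V] [InnerProductSpace ℝ V]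
    (J : EuclideanJordanAlgebra X) (G : X →ₗ[ℝ] V) (P : ProperCone ℝ V) : Prop where
  image_eq : G '' J.symCone = (P : Set V)
  map_primitive_ne_zero : ∀ c, J.IsPrimitive c → G c ≠ 0
  pointed : ∀ u ∈ P, -u ∈ P → u = 0

/-- The gradient of a real function on a finite-dimensional inner product space. -/
noncomputable def grad {E : Type*} [NormedAddCommGroup E] [InnerProductSpace ℝ E]
    [FiniteDimensional ℝ E] (f : E → ℝ) (x : E) : E :=
  haveI : CompleteSpace E := FiniteDimensional.complete ℝ E
  gradient f x

/-- The data of an optimization problem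
`min Ψ(x, y)  s.t.  x ∈ KX, φ₁(x) = 0, y ∈ KY, φ₂(y) = 0`. -/
structure ConeProgram (X Y : Type*) where
  KX : Set X
  KY : Set Y
  Ψ : X → Y → ℝ
  φ₁ : X → ℝ
  φ₂ : Y → ℝ

namespace ConeProgram

/-- `(x, y)` satisfies the constraints of the problem. -/
def IsFeasible {X Y : Type*} (p : ConeProgram X Y) (x : X) (y : Y) : Prop :=
  (x ∈ p.KX ∧ p.φ₁ x = 0) ∧ (y ∈ p.KY ∧ p.φ₂ y = 0)

/-- `(x, y)` is a solution, i.e. a global minimizer, of the problem. -/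
def IsSolution {X Y : Type*} (p : ConeProgram X Y) (x : X) (y : Y) : Prop :=
  p.IsFeasible x y ∧ ∀ x' y', p.IsFeasible x' y' → p.Ψ x y ≤ p.Ψ x' y'

/-- `(x, y)` is a stationary point of the problem: the functions are differentiable there and,
for some multipliers `γ₁ γ₂`,
`KX ∋ x ⊥ ∇ₓΨ(x, y) + γ₁ ∇φ₁(x) ∈ KX*`, `KY ∋ y ⊥ ∇_yΨ(x, y) + γ₂ ∇φ₂(y) ∈ KY*`,
`φ₁(x) = 0`, `φ₂(y) = 0`. -/
def IsStationary {X Y : Type*} [NormedAddCommGroup X] [InnerProductSpace ℝ X]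
    [FiniteDimensional ℝ X] [NormedAddCommGroup Y] [InnerProductSpace ℝ Y]
    [FiniteDimensional ℝ Y] (p : ConeProgram X Y) (x : X) (y : Y) : Prop :=
  DifferentiableAt ℝ (fun q : X × Y => p.Ψ q.1 q.2) (x, y) ∧
  DifferentiableAt ℝ p.φ₁ x ∧ DifferentiableAt ℝ p.φ₂ y ∧
  ∃ γ₁ γ₂ : ℝ,
    (x ∈ p.KX ∧ ⟪x, grad (fun x' => p.Ψ x' y) x + γ₁ • grad p.φ₁ x⟫_ℝ = 0 ∧
      grad (fun x' => p.Ψ x' y) x + γ₁ • grad p.φ₁ x ∈ ProperCone.innerDual p.KX) ∧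
    (y ∈ p.KY ∧ ⟪y, grad (fun y' => p.Ψ x y') y + γ₂ • grad p.φ₂ y⟫_ℝ = 0 ∧
      grad (fun y' => p.Ψ x y') y + γ₂ • grad p.φ₂ y ∈ ProperCone.innerDual p.KY) ∧
    p.φ₁ x = 0 ∧ p.φ₂ y = 0

end ConeProgram

section Programs

variable {X Y V : Type*} [NormedAddCommGroup X] [InnerProductSpace ℝ X] [FiniteDimensional ℝ X]
  [NormedAddCommGroup Y] [InnerProductSpace ℝ Y] [FiniteDimensional ℝ Y]
  [NormedAddCommGroup V] [InnerProductSpace ℝ V]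

/-- The fractional program: minimize `⟨Gx, Hy⟩ / (‖Gx‖ ‖Hy‖)` over the product of the
spectraplexes `{x ∈ K_X : ⟨e_X, x⟩ = 1}` and `{y ∈ K_Y : ⟨e_Y, y⟩ = 1}`. -/
noncomputable def fractionalProgram (JX : EuclideanJordanAlgebra X) (JY : EuclideanJordanAlgebra Y)
    (G : X →ₗ[ℝ] V) (H : Y →ₗ[ℝ] V) : ConeProgram X Y where
  KX := JX.symCone
  KY := JY.symCone
  Ψ x y := ⟪G x, H y⟫_ℝ / (‖G x‖ * ‖H y‖)
  φ₁ x := ⟪JX.e, x⟫_ℝ - 1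
  φ₂ y := ⟪JY.e, y⟫_ℝ - 1

/-- The biconvex parametric program with parameter `δ`: minimize `⟨Gx, Hy⟩ - δ ‖Gx‖ ‖Hy‖` over
the product of the spectraplexes. -/
noncomputable def biconvexProgram (JX : EuclideanJordanAlgebra X) (JY : EuclideanJordanAlgebra Y)
    (G : X →ₗ[ℝ] V) (H : Y →ₗ[ℝ] V) (δ : ℝ) : ConeProgram X Y where
  KX := JX.symCone
  KY := JY.symCone
  Ψ x y := ⟪G x, H y⟫_ℝ - δ * ‖G x‖ * ‖H y‖
  φ₁ x := ⟪JX.e, x⟫_ℝ - 1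
  φ₂ y := ⟪JY.e, y⟫_ℝ - 1

end Programs

/-! This is Dinkelbach's argument. Where the denominator `D = ‖Gx‖ ‖Hy‖` is positive, the choice of
`δ` makes each partial gradient of the quotient `D⁻¹` times that of the parametric objective, and
multipliers rescale along with it. The parametric objective vanishes at `(x, y)`, so minimality
there says that the quotient is at least `δ` everywhere. The real work is `D > 0` on the feasible
set (`IsLISC.map_ne_zero`). A square is a nonnegative combination of idempotents, and pointedness of
the image cone reduces `G x = 0` first to idempotents, then to primitive ones. -/

/-! ### Power associativity -/

namespace EuclideanJordanAlgebra

variable {X : Type*} [NormedAddCommGroup X] [InnerProductSpace ℝ X] [FiniteDimensional ℝ X]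

/-- The polarized Jordan identity. -/
theorem jordan_polarized (J : EuclideanJordanAlgebra X) (x y z : X) :
    J.mul (J.mul (J.mul x x) z) y =
      J.mul (J.mul x x) (J.mul z y) - (2 : ℝ) • J.mul x (J.mul z (J.mul x y)) +
        (2 : ℝ) • J.mul (J.mul x z) (J.mul x y) := by
  -- Half the difference of the identities at `x + y` and `x - y` keeps the terms odd in `y`; `h3`
  -- removes the cubic ones.
  have h1 := J.jordan (x + y) z
  have h2 := J.jordan (x - y) z
  have h3 := J.jordan y z
  simp only [map_add, map_sub, LinearMap.add_apply, LinearMap.sub_apply] at h1 h2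
  rw [J.mul_comm y x] at h1 h2
  rw [J.mul_comm (J.mul (J.mul x x) z) y, J.mul_comm z y, J.mul_comm z (J.mul x y),
    J.mul_comm (J.mul x z) (J.mul x y)]
  linear_combination (norm := module) (1 / 2 : ℝ) • h1 - (1 / 2 : ℝ) • h2 - h3

/-- The powers `x ^ n` act by operators commuting with multiplication by `x` and by `x ^ 2`. -/
theorem commute_mul_pow (J : EuclideanJordanAlgebra X) (x : X) (n : ℕ) :
    Commute (J.mul x) (J.mul ((J.mul x ^ n) J.e)) ∧
      Commute (J.mul (J.mul x x)) (J.mul ((J.mul x ^ n) J.e)) := by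
  have hxx : Commute (J.mul x) (J.mul (J.mul x x)) := LinearMap.ext fun y => J.jordan x y
  have he : J.mul J.e = 1 := LinearMap.ext fun y => J.e_mul y
  have hxe : J.mul x J.e = x := by rw [J.mul_comm, J.e_mul]
  induction n using Nat.twoStepInduction with
  | zero => simp [he]
  | one => simpa [hxe] using hxx.symm
  | more n ih0 ih1 =>
    have hpow : (J.mul x ^ (n + 2)) J.e = J.mul (J.mul x x) ((J.mul x ^ n) J.e) := by
      have h := LinearMap.congr_fun (hxx.pow_left n) J.e
      simp only [Module.End.mul_apply] at h
      rw [← h, J.mul_comm (J.mul x x) J.e, J.e_mul, pow_add]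
      simp [pow_two, hxe]
    -- Polarization at the operator level is a recursion, so commutation passes from `n` and `n + 1`
    -- to `n + 2`.
    have hop : J.mul ((J.mul x ^ (n + 2)) J.e) =
        J.mul (J.mul x x) * J.mul ((J.mul x ^ n) J.e) -
          (2 : ℝ) • (J.mul x * (J.mul ((J.mul x ^ n) J.e) * J.mul x)) +
          (2 : ℝ) • (J.mul ((J.mul x ^ (n + 1)) J.e) * J.mul x) := by
      ext y
      rw [hpow, jordan_polarized]
      simp [pow_succ']
    rw [hop]
    constructor
    · exact ((hxx.mul_right ih0.1).sub_right (((Commute.refl _).mul_right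
        (ih0.1.mul_right (Commute.refl _))).smul_right _)).add_right
        ((ih1.1.mul_right (Commute.refl _)).smul_right _)
    · exact (((Commute.refl _).mul_right ih0.2).sub_right ((hxx.symm.mul_right
        (ih0.2.mul_right hxx.symm)).smul_right _)).add_right
        ((ih1.2.mul_right hxx.symm).smul_right _)

open Polynomial in
/-- Polynomials in a fixed element multiply as polynomials do. -/
theorem mul_aeval (J : EuclideanJordanAlgebra X) (x : X) (p q : ℝ[X]) :
    J.mul (aeval (J.mul x) p J.e) (aeval (J.mul x) q J.e) = aeval (J.mul x) (p * q) J.e := by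
  have hp : Commute (J.mul (aeval (J.mul x) p J.e)) (J.mul x) := by
    induction p using Polynomial.induction_on' with
    | add p q hp hq => simpa using hp.add_left hq
    | monomial n a =>
      simpa [aeval_monomial, Module.algebraMap_end_apply] using
        ((J.commute_mul_pow x n).1.symm.smul_left a)
  have hq : Commute (J.mul (aeval (J.mul x) p J.e)) (aeval (J.mul x) q) := by
    induction q using Polynomial.induction_on' with
    | add q r hq hr => simpa using hq.add_right hr
    | monomial n a =>
      rw [aeval_monomial]
      exact Commute.mul_right (Algebra.commutes a _).symm (hp.pow_right n)
  have h := LinearMap.congr_fun hq J.e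
  simp only [Module.End.mul_apply] at h
  rw [h, J.mul_comm _ J.e, J.e_mul, _root_.mul_comm p q, map_mul, Module.End.mul_apply]

/-! ### Spectral decomposition and idempotents -/

open Polynomial in
/-- The spectral decomposition of an element and of its square. -/
theorem exists_spectral_decomposition (J : EuclideanJordanAlgebra X) (x : X) :
    ∃ (s : Finset ℝ) (c : ℝ → X), (∀ r ∈ s, J.IsIdempotent (c r)) ∧
      x = ∑ r ∈ s, r • c r ∧ J.mul x x = ∑ r ∈ s, r ^ 2 • c r := by
  classical
  have hT : (J.mul x).IsSymmetric := J.inner_mul x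
  let b := hT.eigenvectorBasis rfl
  let μ := hT.eigenvalues rfl
  let s : Finset ℝ := Finset.univ.image μ
  -- Multiplication by `x` is self-adjoint, hence diagonalizable: a polynomial in it depends only on
  -- its values on the spectrum `s`.
  have key : ∀ p q : ℝ[X], (∀ r ∈ s, p.eval r = q.eval r) →
      aeval (J.mul x) p = aeval (J.mul x) q := by
    intro p q h
    refine b.toBasis.ext fun i => ?_
    have hb := hT.hasEigenvector_eigenvectorBasis rfl i
    have hi := h (μ i) (Finset.mem_image_of_mem _ (Finset.mem_univ i))
    rw [OrthonormalBasis.coe_toBasis]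
    erw [Module.End.aeval_apply_of_hasEigenvector hb, Module.End.aeval_apply_of_hasEigenvector hb]
    exact congrArg (· • b i) hi
  have hxe : J.mul x J.e = x := by rw [J.mul_comm, J.e_mul]
  have hinj : Set.InjOn (id : ℝ → ℝ) s := Function.injective_id.injOn
  have eval_basis : ∀ r ∈ s, ∀ t ∈ s, (Lagrange.basis s id r).eval t = if r = t then 1 else 0 := by
    intro r hr t ht
    split_ifs with h
    · subst h
      exact Lagrange.eval_basis_self hinj hr
    · exact Lagrange.eval_basis_of_ne (v := id) h ht
  have eval_sum : ∀ f : ℝ → ℝ, ∀ t ∈ s,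
      (∑ r ∈ s, C (f r) * Lagrange.basis s id r).eval t = f t := by
    intro f t ht
    rw [eval_finsetSum, Finset.sum_eq_single_of_mem t ht]
    · simp [eval_basis t ht t ht]
    · intro r hr hne
      simp [eval_basis r hr t ht, hne]
  have expand : ∀ f : ℝ → ℝ, aeval (J.mul x) (∑ r ∈ s, C (f r) * Lagrange.basis s id r) J.e =
      ∑ r ∈ s, f r • aeval (J.mul x) (Lagrange.basis s id r) J.e := by
    intro f
    simp [LinearMap.sum_apply, Module.algebraMap_end_apply]
  -- Lagrange polynomials take values 0 and 1 on `s`, whence idempotents; some may be zero.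
  refine ⟨s, fun r => aeval (J.mul x) (Lagrange.basis s id r) J.e, fun r hr => ?_, ?_, ?_⟩
  · rw [IsIdempotent, mul_aeval, key _ (Lagrange.basis s id r)]
    intro t ht
    rw [eval_mul, eval_basis r hr t ht]
    split_ifs <;> simp
  · rw [← expand fun r => r, key _ Polynomial.X fun t ht => by rw [eval_sum _ t ht, eval_X],
      aeval_X, hxe]
  · rw [← expand fun r => r ^ 2,
      key _ (Polynomial.X ^ 2) fun t ht => by rw [eval_sum _ t ht, eval_pow, eval_X]]
    simp [pow_two, hxe]

/-- Two idempotents whose sum is idempotent are orthogonal. -/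
theorem IsIdempotent.inner_eq_zero {J : EuclideanJordanAlgebra X} {a b : X}
    (ha : J.IsIdempotent a) (hb : J.IsIdempotent b) (hab : J.IsIdempotent (a + b)) :
    ⟪a, b⟫_ℝ = 0 := by
  unfold IsIdempotent at ha hb hab
  have h0 : J.mul a b = 0 := by
    simp only [map_add, LinearMap.add_apply, ha, hb, J.mul_comm b a] at hab
    linear_combination (norm := module) (1 / 2 : ℝ) • hab
  have h := J.inner_mul a J.e b
  rwa [h0, inner_zero_right, J.mul_comm, J.e_mul] at h

/-- Nonzero idempotents are bounded away from zero. -/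
theorem exists_pos_le_norm_sq (J : EuclideanJordanAlgebra X) :
    ∃ ε > 0, ∀ c, J.IsIdempotent c → c ≠ 0 → ε ≤ ‖c‖ ^ 2 := by
  let B : X →L[ℝ] X →L[ℝ] X :=
    LinearMap.toContinuousLinearMap
      ((LinearMap.toContinuousLinearMap : (X →ₗ[ℝ] X) ≃ₗ[ℝ] X →L[ℝ] X).toLinearMap ∘ₗ J.mul)
  have hB : ∀ c, ‖J.mul c c‖ ≤ ‖B‖ * ‖c‖ * ‖c‖ := fun c => B.le_opNorm₂ c c
  -- From `c = c ∘ c` follows `‖c‖ ≤ ‖B‖ ‖c‖²`; the `+ 1` avoids inverting a possibly zero norm.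
  refine ⟨((‖B‖ + 1)⁻¹) ^ 2, by positivity, fun c hc h0 => ?_⟩
  have hpos : 0 < ‖c‖ := norm_pos_iff.mpr h0
  have h := hB c
  rw [hc] at h
  have h1 : 1 ≤ ‖B‖ * ‖c‖ := by
    by_contra! hlt
    nlinarith
  gcongr
  rw [inv_le_iff_one_le_mul₀ (by positivity)]
  nlinarith

/-- Every idempotent lies in the symmetric cone. -/
theorem IsIdempotent.mem_symCone {J : EuclideanJordanAlgebra X} {c : X} (hc : J.IsIdempotent c) :
    c ∈ J.symCone := ⟨c, hc.symm⟩

end EuclideanJordanAlgebra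

/-! ### Nonvanishing on the symmetric cone -/

namespace IsLISC

variable {X V : Type*} [NormedAddCommGroup X] [InnerProductSpace ℝ X] [FiniteDimensional ℝ X]
  [NormedAddCommGroup V] [InnerProductSpace ℝ V]
  {J : EuclideanJordanAlgebra X} {G : X →ₗ[ℝ] V} {P : ProperCone ℝ V}

theorem map_mem (h : IsLISC J G P) {x : X} (hx : x ∈ J.symCone) : G x ∈ P := by
  have : G x ∈ (P : Set V) := h.image_eq ▸ Set.mem_image_of_mem G hx
  exact this

theorem eq_zero_of_add_eq_zero (h : IsLISC J G P) {u v : V} (hu : u ∈ P) (hv : v ∈ P)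
    (huv : u + v = 0) : u = 0 :=
  h.pointed u hu (by rwa [neg_eq_of_add_eq_zero_right huv])

/-- Descent on `‖c‖²`: a non-primitive `c` killed by `G` splits into orthogonal idempotents, both
killed by pointedness, and passing to one summand lowers `‖c‖²` by at least `ε`. -/
theorem map_idempotent_ne_zero (h : IsLISC J G P) {c : X} (hc : J.IsIdempotent c) (h0 : c ≠ 0) :
    G c ≠ 0 := by
  obtain ⟨ε, hε, hle⟩ := J.exists_pos_le_norm_sq
  have main : ∀ (n : ℕ) (c : X), J.IsIdempotent c → c ≠ 0 → ‖c‖ ^ 2 ≤ n * ε → G c ≠ 0 := by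
    intro n
    induction n with
    | zero =>
      intro c hc h0 hn
      have := hle c hc h0
      simp only [Nat.cast_zero, zero_mul] at hn
      linarith
    | succ n ih =>
      intro c hc h0 hn hG
      by_cases hp : J.IsPrimitive c
      · exact h.map_primitive_ne_zero c hp hG
      · obtain ⟨a, b, ha, ha0, hb, hb0, rfl⟩ : ∃ a b, J.IsIdempotent a ∧ a ≠ 0 ∧
            J.IsIdempotent b ∧ b ≠ 0 ∧ c = a + b := by
          by_contra hno
          exact hp ⟨hc, h0, hno⟩
        refine ih a ha ha0 ?_ (h.eq_zero_of_add_eq_zero (h.map_mem ha.mem_symCone)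
          (h.map_mem hb.mem_symCone) (by rw [← map_add, hG]))
        have hab := norm_add_sq_real a b
        rw [ha.inner_eq_zero hb hc] at hab
        have := hle b hb hb0
        push_cast at hn
        linarith
  obtain ⟨n, hn⟩ := exists_nat_ge (‖c‖ ^ 2 / ε)
  exact main n c hc h0 ((div_le_iff₀ hε).mp hn)

/-- The linear map defining a LISC cone vanishes on the symmetric cone only at the origin. -/
theorem map_ne_zero (h : IsLISC J G P) {x : X} (hx : x ∈ J.symCone) (h0 : x ≠ 0) : G x ≠ 0 := by
  obtain ⟨z, rfl⟩ := hx
  obtain ⟨s, c, hc, hz, hzz⟩ := J.exists_spectral_decomposition z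
  intro hG
  have hmem : ∀ r ∈ s, r ^ 2 • G (c r) ∈ P := fun r hr =>
    P.smul_mem (h.map_mem (hc r hr).mem_symCone) (sq_nonneg r)
  have hsum : ∑ r ∈ s, r ^ 2 • G (c r) = 0 := by
    rw [hzz] at hG
    simpa using hG
  apply h0
  rw [hzz]
  refine Finset.sum_eq_zero fun r hr => ?_
  have hr0 : r ^ 2 • G (c r) = 0 := by
    have hrest : ∑ t ∈ s.erase r, t ^ 2 • G (c t) ∈ P.toSubmodule :=
      Submodule.sum_mem _ fun t ht => hmem t (Finset.mem_of_mem_erase ht)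
    refine h.eq_zero_of_add_eq_zero (hmem r hr) hrest ?_
    rw [← hsum]
    exact Finset.add_sum_erase s (fun t => t ^ 2 • G (c t)) hr
  rcases smul_eq_zero.mp hr0 with h2 | hc0
  · rw [h2, zero_smul]
  · by_cases hcr : c r = 0
    · rw [hcr, smul_zero]
    · exact absurd hc0 (h.map_idempotent_ne_zero (hc r hr) hcr)

theorem map_ne_zero_of_inner_eq_one (h : IsLISC J G P) {x : X} (hx : x ∈ J.symCone)
    (h1 : ⟪J.e, x⟫_ℝ - 1 = 0) : G x ≠ 0 := by
  refine h.map_ne_zero hx ?_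
  rintro rfl
  simp at h1

end IsLISC

/-! ### Gradients and stationarity -/

section Calculus

variable {E : Type*} [NormedAddCommGroup E] [InnerProductSpace ℝ E] [FiniteDimensional ℝ E]

/-- The gradient of a quotient is a multiple of that of its Dinkelbach parametrization. -/
theorem grad_div_eq_smul_grad_sub {N D : E → ℝ} {x : E} (hN : DifferentiableAt ℝ N x)
    (hD : DifferentiableAt ℝ D x) (h0 : D x ≠ 0) :
    grad (fun u => N u / D u) x = (D x)⁻¹ • grad (fun u => N u - N x / D x * D u) x := by
  have : CompleteSpace E := FiniteDimensional.complete ℝ E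
  have h1 : fderiv ℝ (fun u => N u / D u) x =
      N x • (-(D x ^ 2)⁻¹) • fderiv ℝ D x + (D x)⁻¹ • fderiv ℝ N x := by
    simp only [div_eq_mul_inv]
    exact (hN.hasFDerivAt.mul ((hasDerivAt_inv h0).comp_hasFDerivAt x hD.hasFDerivAt)).fderiv
  have h2 := (hN.hasFDerivAt.fun_sub (hD.hasFDerivAt.const_mul (N x / D x))).fderiv
  simp only [grad, gradient]
  have hL : fderiv ℝ (fun u => N u / D u) x =
      (D x)⁻¹ • fderiv ℝ (fun u => N u - N x / D x * D u) x := by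
    rw [h1, h2]
    ext v
    simp
    field_simp
    ring
  rw [hL, map_smulₛₗ]
  rfl

end Calculus

namespace ConeProgram

variable {X Y : Type*} [NormedAddCommGroup X] [InnerProductSpace ℝ X] [FiniteDimensional ℝ X]
  [NormedAddCommGroup Y] [InnerProductSpace ℝ Y] [FiniteDimensional ℝ Y]

/-- Stationarity only depends on the objective through its partial gradients up to a positive
factor. -/
theorem IsStationary.of_grad_eq_smul {p : ConeProgram X Y} {x : X} {y : Y}
    (h : p.IsStationary x y) {Ψ : X → Y → ℝ} {t : ℝ} (ht : 0 < t)
    (hΨ : DifferentiableAt ℝ (fun q : X × Y => Ψ q.1 q.2) (x, y))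
    (hX : grad (fun x' => Ψ x' y) x = t • grad (fun x' => p.Ψ x' y) x)
    (hY : grad (fun y' => Ψ x y') y = t • grad (fun y' => p.Ψ x y') y) :
    ({ p with Ψ := Ψ } : ConeProgram X Y).IsStationary x y := by
  obtain ⟨-, h1, h2, γ₁, γ₂, ⟨hx, hx0, hxd⟩, ⟨hy, hy0, hyd⟩, hf⟩ := h
  refine ⟨hΨ, h1, h2, t * γ₁, t * γ₂, ⟨hx, ?_, ?_⟩, ⟨hy, ?_, ?_⟩, hf⟩
  · simp only [hX, mul_smul, ← smul_add, inner_smul_right, hx0, mul_zero]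
  · simp only [hX, mul_smul, ← smul_add]
    exact ProperCone.smul_mem _ hxd ht.le
  · simp only [hY, mul_smul, ← smul_add, inner_smul_right, hy0, mul_zero]
  · simp only [hY, mul_smul, ← smul_add]
    exact ProperCone.smul_mem _ hyd ht.le

theorem IsStationary.isFeasible {p : ConeProgram X Y} {x : X} {y : Y} (h : p.IsStationary x y) :
    p.IsFeasible x y := by
  obtain ⟨-, -, -, γ₁, γ₂, ⟨hx, -⟩, ⟨hy, -⟩, h1, h2⟩ := h
  exact ⟨⟨hx, h1⟩, hy, h2⟩

end ConeProgram

theorem theorem4p1 {X Y V : Type*}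
    [NormedAddCommGroup X] [InnerProductSpace ℝ X] [FiniteDimensional ℝ X]
    [NormedAddCommGroup Y] [InnerProductSpace ℝ Y] [FiniteDimensional ℝ Y]
    [NormedAddCommGroup V] [InnerProductSpace ℝ V] [FiniteDimensional ℝ V]
    (JX : EuclideanJordanAlgebra X) (JY : EuclideanJordanAlgebra Y)
    (G : X →ₗ[ℝ] V) (H : Y →ₗ[ℝ] V) (P Q : ProperCone ℝ V)
    (hP : IsLISC JX G P) (hQ : IsLISC JY H Q)
    (x : X) (y : Y) (δ : ℝ) (hδ : δ = ⟪G x, H y⟫_ℝ / (‖G x‖ * ‖H y‖)) :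
    ((biconvexProgram JX JY G H δ).IsStationary x y ↔
      (fractionalProgram JX JY G H).IsStationary x y) ∧
    ((biconvexProgram JX JY G H δ).IsSolution x y ↔
      (fractionalProgram JX JY G H).IsSolution x y) := by
  have hpos : ∀ x' y', (fractionalProgram JX JY G H).IsFeasible x' y' →
      0 < ‖G x'‖ * ‖H y'‖ := fun x' y' h =>
    mul_pos (norm_pos_iff.mpr (hP.map_ne_zero_of_inner_eq_one h.1.1 h.1.2))
      (norm_pos_iff.mpr (hQ.map_ne_zero_of_inner_eq_one h.2.1 h.2.2))
  constructor
  -- Both programs have the same constraints, so off the feasible set neither side holds; on it the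
  -- norms are nonzero, hence differentiable.
  · by_cases hf : (fractionalProgram JX JY G H).IsFeasible x y
    swap
    · exact ⟨fun h => absurd h.isFeasible hf, fun h => absurd h.isFeasible hf⟩
    have hD := hpos x y hf
    have hGx : G x ≠ 0 := hP.map_ne_zero_of_inner_eq_one hf.1.1 hf.1.2
    have hHy : H y ≠ 0 := hQ.map_ne_zero_of_inner_eq_one hf.2.1 hf.2.2
    have dG : Differentiable ℝ G := (LinearMap.toContinuousLinearMap G).differentiable
    have dH : Differentiable ℝ H := (LinearMap.toContinuousLinearMap H).differentiable
    have dGp : DifferentiableAt ℝ (fun q : X × Y => G q.1) (x, y) :=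
      (dG x).comp (x, y) differentiableAt_fst
    have dHp : DifferentiableAt ℝ (fun q : X × Y => H q.2) (x, y) :=
      (dH y).comp (x, y) differentiableAt_snd
    have dI := dGp.inner ℝ dHp
    have dnG := dGp.norm ℝ hGx
    have dnH := dHp.norm ℝ hHy
    have dF : DifferentiableAt ℝ
        (fun q : X × Y => ⟪G q.1, H q.2⟫_ℝ / (‖G q.1‖ * ‖H q.2‖)) (x, y) := by
      simp only [div_eq_mul_inv]
      exact dI.fun_mul ((dnG.fun_mul dnH).fun_inv hD.ne')
    have dB : DifferentiableAt ℝ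
        (fun q : X × Y => ⟪G q.1, H q.2⟫_ℝ - δ * ‖G q.1‖ * ‖H q.2‖) (x, y) :=
      dI.fun_sub ((dnG.const_mul δ).fun_mul dnH)
    have gX : grad (fun u => ⟪G u, H y⟫_ℝ / (‖G u‖ * ‖H y‖)) x = (‖G x‖ * ‖H y‖)⁻¹ •
        grad (fun u => ⟪G u, H y⟫_ℝ - δ * ‖G u‖ * ‖H y‖) x := by
      have h := grad_div_eq_smul_grad_sub (N := fun u => ⟪G u, H y⟫_ℝ)
        (D := fun u => ‖G u‖ * ‖H y‖) (x := x) ((dG x).inner ℝ (differentiableAt_const _))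
        (((dG x).norm ℝ hGx).mul_const _) hD.ne'
      simpa only [← hδ, ← mul_assoc] using h
    have gY : grad (fun v => ⟪G x, H v⟫_ℝ / (‖G x‖ * ‖H v‖)) y = (‖G x‖ * ‖H y‖)⁻¹ •
        grad (fun v => ⟪G x, H v⟫_ℝ - δ * ‖G x‖ * ‖H v‖) y := by
      have h := grad_div_eq_smul_grad_sub (N := fun v => ⟪G x, H v⟫_ℝ)
        (D := fun v => ‖G x‖ * ‖H v‖) (x := y) ((differentiableAt_const _).inner ℝ (dH y))
        (((dH y).norm ℝ hHy).const_mul _) hD.ne'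
      simpa only [← hδ, ← mul_assoc] using h
    constructor
    · exact fun h => h.of_grad_eq_smul (inv_pos.mpr hD) dF gX gY
    · exact fun h => h.of_grad_eq_smul hD dB ((inv_smul_eq_iff₀ hD.ne').mp gX.symm)
        ((inv_smul_eq_iff₀ hD.ne').mp gY.symm)
  · refine and_congr_right fun hf => forall₃_congr fun x' y' hf' => ?_
    have hD := hpos x y hf
    have hD' := hpos x' y' hf'
    have hz : ⟪G x, H y⟫_ℝ - δ * ‖G x‖ * ‖H y‖ = 0 := by
      rw [mul_assoc, hδ, div_mul_cancel₀ _ hD.ne', sub_self]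
    simp only [biconvexProgram, fractionalProgram]
    rw [hz, ← hδ, le_div_iff₀ hD', sub_nonneg, mul_assoc]
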